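/- Let $X^*$ be a random target in $\mathcal X\subset\mathbb R^d$ with prior probability density $p_0$ of finite differential entropy, $\int p_0|\log_2 p_0|\,dx<\infty$, and let there be $M$ players. At each time $n=0,\dots,N-1$ a controller chooses, as a function of the responses $Y_1,\dots,Y_n\in\{0,1\}$ received so far, one player $u_n\in\{1,\dots,M\}$ and a query region $A_n$, which must be a union of at most $J_n(u_n)$ half-open rectangles $[a_1,b_1)\times\cdots\times[a_d,b_d)\subseteq\mathcal X$. Given $X^*$ and the past, the response $Y_{n+1}$ of player $u_n$ is the output of a binary symmetric channel with input $I(X^*\in A_n)$ and known crossover probability $\epsilon_n(u_n)\in(0,1/2)$: it equals the input with probability $1-\epsilon_n(u_n)$. Let $p_n$ be the posterior density of $X^*$ after $n$ responses, given by Bayes' rule, let $H(p)=-\int p\log_2 p\,dx$, and let $T_N=\sum_{k=0}^{N-1}K_k(u_k,A_k)$ be the total cost, where $K_k(u,A)\in\mathbb R$ is the cost of asking player $u$ the query $A$ at time $k$. For $\gamma\ge 0$ consider the problem $$\inf_\zeta \mathbb E^\zeta\left[H(p_N)+\gamma T_N\right],$$ where $\zeta$ ranges over all such policies. Assume that the cost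 is independent of the query, $K_k(u,A)=K_k(u)$, and let $C_n(u)=1-h_b(\epsilon_n(u))$ be the Shannon capacity (in bits) of the channel of player $u$ at time $n$, where $h_b(\epsilon)=-\epsilon\log_2\epsilon-(1-\epsilon)\log_2(1-\epsilon)$. Then a policy is optimal, i.e. attains this infimum, if for every $n=0,\dots,N-1$ and all responses received so far the selected player $u_n$ attains $$\max_{u\in\{1,\dots,M\}}\left\{C_n(u)-\gamma K_n(u)\right\}$$ and the query $A_n$ is a bisection of the posterior density, $\int_{A_n}p_n(x)\,dx=\tfrac12$. -/

import Mathlib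

open MeasureTheory

noncomputable section

namespace TwentyQuestions

/-- The target space `ℝ^d`, with Lebesgue measure `volume`. -/
abbrev Target (d : ℕ) : Type := Fin d → ℝ

/-- Differential entropy in bits, `H(p) = -∫ p(x) log₂ p(x) dx`. -/
def entropy {d : ℕ} (p : Target d → ℝ) : ℝ :=
  -∫ x, p x * Real.logb 2 (p x)

/-- `p` is a probability density on `ℝ^d` that is supported in `S`. -/
structure IsDensityOn {d : ℕ} (S : Set (Target d)) (p : Target d → ℝ) : Prop where
  measurable : Measurable p
  nonneg : ∀ x, 0 ≤ p x
  eq_zero : ∀ x, x ∉ S → p x = 0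
  integrable : Integrable p volume
  integral_eq_one : ∫ x, p x = 1

/-- The probability mass a density `p` gives to a set `A`. -/
def mass {d : ℕ} (p : Target d → ℝ) (A : Set (Target d)) : ℝ :=
  ∫ x in A, p x

/-- Transition probabilities `W(y | z)` of the binary symmetric channel with crossover
probability `ε` (first Boolean argument: input `z`, second one: output `y`). -/
def bsc (ε : ℝ) (z y : Bool) : ℝ :=
  if y = z then 1 - ε else ε

/-- Mutual information (in bits) between the input, distributed as `π`, and the output of the
binary-input binary-output channel `W`. -/
def mutualInfo (π : Bool → ℝ) (W : Bool → Bool → ℝ) : ℝ :=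
  ∑ z, ∑ y, π z * W z y * Real.logb 2 (W z y / ∑ z', π z' * W z' y)

/-- Shannon capacity (in bits) of a binary-input binary-output channel: the supremum of the mutual
information over all input distributions. -/
def capacity (W : Bool → Bool → ℝ) : ℝ :=
  sSup {c : ℝ | ∃ π : Bool → ℝ, (∀ z, 0 ≤ π z) ∧ ∑ z, π z = 1 ∧ c = mutualInfo π W}

/-- The true answer `I(x ∈ A)` to the question whether `x` lies in `A`. -/
def truth {d : ℕ} (A : Set (Target d)) (x : Target d) : Bool :=
  open Classical in decide (x ∈ A)

/-- Bayes' rule: the posterior density when the density `p` is updated with the response `y` of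
a player with crossover probability `ε` to the query region `A`. -/
def bayesUpdate {d : ℕ} (ε : ℝ) (A : Set (Target d)) (y : Bool) (p : Target d → ℝ) :
    Target d → ℝ :=
  fun x => bsc ε (truth A x) y * p x / ∫ x', bsc ε (truth A x') y * p x'

/-- The half-open rectangle `[a₁, b₁) × ⋯ × [a_d, b_d)`. -/
def rectangle {d : ℕ} (a b : Target d) : Set (Target d) :=
  Set.pi Set.univ fun l => Set.Ico (a l) (b l)

/-- `A` is a union of at most `J` half-open rectangles contained in `S`. -/
def IsQueryRegion {d : ℕ} (S : Set (Target d)) (J : ℕ) (A : Set (Target d)) : Prop :=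
  ∃ j ≤ J, ∃ a b : Fin j → Target d,
    (∀ i l, a i l ≤ b i l) ∧ (∀ i, rectangle (a i) (b i) ⊆ S) ∧
      A = ⋃ i, rectangle (a i) (b i)

/-- The data of the player-selection problem with `M` players and a target in `ℝ^d`. -/
structure Problem (d M : ℕ) where
  /-- the region containing the target -/
  domain : Set (Target d)
  /-- the prior density of the target -/
  prior : Target d → ℝ
  /-- crossover probability of each player at each time -/
  crossover : ℕ → Fin M → ℝ
  /-- maximal number of rectangles in a query to each player at each time -/
  maxRect : ℕ → Fin M → ℕ
  /-- `cost k u A` is the cost of asking player `u` the query `A` at time `k` -/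
  cost : ℕ → Fin M → Set (Target d) → ℝ
  /-- the tradeoff parameter -/
  γ : ℝ
  /-- the number of questions -/
  horizon : ℕ

/-- A control policy: at time `n`, when the responses `y₁, …, yₙ` have been received, it selects the
player to be asked and the query. (The earlier players and queries are functions of the earlier
responses, so they carry no further information.) -/
structure Policy (d M : ℕ) where
  player : (n : ℕ) → (Fin n → Bool) → Fin M
  query : (n : ℕ) → (Fin n → Bool) → Set (Target d)

namespace Problem

variable {d M : ℕ} (P : Problem d M)

/-- Capacity `C_n(u)` of player `u` at time `n`. -/
def playerCapacity (n : ℕ) (u : Fin M) : ℝ :=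
  capacity (bsc (P.crossover n u))

/-- A policy is admissible if all its queries up to the horizon are permitted query regions. -/
def Admissible (ζ : Policy d M) : Prop :=
  ∀ n < P.horizon, ∀ y : Fin n → Bool,
    IsQueryRegion P.domain (P.maxRect n (ζ.player n y)) (ζ.query n y)

/-- The posterior density `p_n` after the responses `y`. -/
def posterior (ζ : Policy d M) : (n : ℕ) → (Fin n → Bool) → Target d → ℝ
  | 0, _ => P.prior
  | n + 1, y =>
      bayesUpdate (P.crossover n (ζ.player n (Fin.init y))) (ζ.query n (Fin.init y))
        (y (Fin.last n)) (posterior ζ n (Fin.init y))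

/-- The cost `T_n = ∑_{k < n} K_k(u_k, A_k)` incurred when the responses are `y`. -/
def totalCost (ζ : Policy d M) : (n : ℕ) → (Fin n → Bool) → ℝ
  | 0, _ => 0
  | n + 1, y =>
      totalCost ζ n (Fin.init y) +
        P.cost n (ζ.player n (Fin.init y)) (ζ.query n (Fin.init y))

/-- The conditional probability, given that the target is at `x`, that the first `n` responses
are `y`: each response is the output of the memoryless channel of the player selected, whose input is
the true answer to the query. -/
def likelihood (ζ : Policy d M) : (n : ℕ) → Target d → (Fin n → Bool) → ℝ
  | 0, _, _ => 1
  | n + 1, x, y =>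
      likelihood ζ n x (Fin.init y) *
        bsc (P.crossover n (ζ.player n (Fin.init y))) (truth (ζ.query n (Fin.init y)) x)
          (y (Fin.last n))

/-- The joint law, under the policy `ζ`, of the target and of the responses up to the horizon. -/
def law (ζ : Policy d M) : Measure (Target d × (Fin P.horizon → Bool)) :=
  ((volume : Measure (Target d)).prod Measure.count).withDensity fun ω =>
    ENNReal.ofReal (P.prior ω.1 * P.likelihood ζ P.horizon ω.1 ω.2)

/-- The criterion `E^ζ[H(p_N) + γ T_N]`. -/
def objective (ζ : Policy d M) : ℝ :=
  ∫ ω, (entropy (P.posterior ζ P.horizon ω.2) + P.γ * P.totalCost ζ P.horizon ω.2) ∂(P.law ζ)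

/-- `ζ` attains the infimum of the criterion over all admissible policies. -/
def IsOptimal (ζ : Policy d M) : Prop :=
  P.Admissible ζ ∧ IsLeast (P.objective '' {ξ | P.Admissible ξ}) (P.objective ζ)

end Problem

end TwentyQuestions

end

/-!
Let `C_n(u)` be the capacity of player `u` at time `n`. Asking player `u` the query `A` lowers the
expected entropy of the posterior by exactly the mutual information between the true answer and
the response. Telescoping, the objective of a policy equals `H(p₀)` minus the expected sum over
`n` of (mutual information at time `n`) `- γ K_n(u_n, A_n)`. Each mutual information is at most
`C_n(u_n)`, with equality when the true answer is uniform, that is, for a bisection. So the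
objective of every policy is at least `H(p₀)` minus the sum over `n` of the maxima of
`C_n(u) - γ K_n(u, A)`, and a policy that bisects and attains these maxima attains this bound.
-/

noncomputable section

namespace TwentyQuestions

section BinaryChannel

lemma mutualInfo_eq_sub {π : Bool → ℝ} {W : Bool → Bool → ℝ} (hπ : ∀ z, 0 ≤ π z)
    (hW : ∀ z y, 0 ≤ W z y) :
    mutualInfo π W = ∑ z, π z * ∑ y, W z y * Real.logb 2 (W z y) -
      ∑ y, (∑ z, π z * W z y) * Real.logb 2 (∑ z, π z * W z y) := by
  have hterm (z y) : π z * W z y * Real.logb 2 (W z y / ∑ z', π z' * W z' y) =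
      π z * (W z y * Real.logb 2 (W z y)) -
        π z * W z y * Real.logb 2 (∑ z', π z' * W z' y) := by
    rcases eq_or_ne (π z * W z y) 0 with h | h
    · rw [← mul_assoc, h]
      simp
    · have hout : ∑ z', π z' * W z' y ≠ 0 := fun h0 =>
        h ((Finset.sum_eq_zero_iff_of_nonneg fun z' _ => mul_nonneg (hπ z') (hW z' y)).1 h0 z
          (Finset.mem_univ z))
      rw [Real.logb_div (right_ne_zero_of_mul h) hout]
      ring
  simp only [mutualInfo, hterm, Finset.sum_sub_distrib, Finset.mul_sum, Finset.sum_mul]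
  congr 1
  exact Finset.sum_comm

lemma sum_mul_logb_two_eq_neg_binEntropy {q : Bool → ℝ} (hq : ∑ y, q y = 1) :
    ∑ y, q y * Real.logb 2 (q y) = -(Real.binEntropy (q true) / Real.log 2) := by
  have hfalse : q false = 1 - q true := by
    rw [Fintype.sum_bool] at hq
    linarith
  simp only [Fintype.sum_bool, hfalse, Real.logb, Real.negMulLog,
    Real.binEntropy_eq_negMulLog_add_negMulLog_one_sub]
  ring

variable {ε : ℝ} {π : Bool → ℝ}

lemma bsc_nonneg (hε : ε ∈ Set.Icc (0 : ℝ) 1) (z y : Bool) : 0 ≤ bsc ε z y := by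
  unfold bsc
  split_ifs
  exacts [sub_nonneg.2 hε.2, hε.1]

lemma sum_bsc (ε : ℝ) (z : Bool) : ∑ y, bsc ε z y = 1 := by
  cases z <;> simp [bsc]

lemma binEntropy_bsc (ε : ℝ) (z y : Bool) : Real.binEntropy (bsc ε z y) = Real.binEntropy ε := by
  unfold bsc
  split_ifs <;> simp

lemma mutualInfo_bsc (hε : ε ∈ Set.Icc (0 : ℝ) 1) (hπ : ∀ z, 0 ≤ π z) (hsum : ∑ z, π z = 1) :
    mutualInfo π (bsc ε) =
      (Real.binEntropy (∑ z, π z * bsc ε z true) - Real.binEntropy ε) / Real.log 2 := by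
  have hout : ∑ y, ∑ z, π z * bsc ε z y = 1 := by
    rw [Finset.sum_comm]
    simp only [← Finset.mul_sum, sum_bsc, mul_one, hsum]
  rw [mutualInfo_eq_sub hπ (bsc_nonneg hε), sum_mul_logb_two_eq_neg_binEntropy hout]
  simp only [sum_mul_logb_two_eq_neg_binEntropy (sum_bsc ε _), binEntropy_bsc, ← Finset.sum_mul,
    hsum]
  ring

lemma isGreatest_mutualInfo_bsc (hε : ε ∈ Set.Icc (0 : ℝ) 1) :
    IsGreatest {c | ∃ π : Bool → ℝ, (∀ z, 0 ≤ π z) ∧ ∑ z, π z = 1 ∧ c = mutualInfo π (bsc ε)}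
      (mutualInfo (fun _ => 1 / 2) (bsc ε)) := by
  have hnonneg : ∀ _ : Bool, (0 : ℝ) ≤ 1 / 2 := fun _ => by norm_num
  have hsum : ∑ _ : Bool, (1 / 2 : ℝ) = 1 := by norm_num
  have hout : ∑ z, 1 / 2 * bsc ε z true = 2⁻¹ := by
    simp only [Fintype.sum_bool, bsc, if_true, Bool.true_eq_false, if_false]
    ring
  refine ⟨⟨_, hnonneg, hsum, rfl⟩, ?_⟩
  rintro _ ⟨π, hπ, hπsum, rfl⟩
  rw [mutualInfo_bsc hε hπ hπsum, mutualInfo_bsc hε hnonneg hsum, hout, Real.binEntropy_two_inv]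
  exact div_le_div_of_nonneg_right (sub_le_sub_right Real.binEntropy_le_log_two _)
    (Real.log_nonneg one_le_two)

lemma capacity_bsc (hε : ε ∈ Set.Icc (0 : ℝ) 1) :
    capacity (bsc ε) = mutualInfo (fun _ => 1 / 2) (bsc ε) :=
  (isGreatest_mutualInfo_bsc hε).csSup_eq

lemma mutualInfo_le_capacity_bsc (hε : ε ∈ Set.Icc (0 : ℝ) 1) (hπ : ∀ z, 0 ≤ π z)
    (hsum : ∑ z, π z = 1) : mutualInfo π (bsc ε) ≤ capacity (bsc ε) :=
  (capacity_bsc hε).symm ▸ (isGreatest_mutualInfo_bsc hε).2 ⟨π, hπ, hsum, rfl⟩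

end BinaryChannel

section Answer

variable {d : ℕ} {A : Set (Target d)} {p : Target d → ℝ}

lemma IsQueryRegion.measurableSet {S : Set (Target d)} {J : ℕ} (h : IsQueryRegion S J A) :
    MeasurableSet A := by
  obtain ⟨j, -, a, b, -, -, rfl⟩ := h
  exact .iUnion fun i => .univ_pi fun l => measurableSet_Ico

lemma measurable_truth (hA : MeasurableSet A) : Measurable (truth A) :=
  measurable_to_bool <| by simpa [truth, Set.preimage] using hA

open Classical in
lemma truth_mul_eq_piecewise (A : Set (Target d)) (f : Bool → ℝ) (p : Target d → ℝ) :
    (fun x => f (truth A x) * p x) =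
      A.piecewise (fun x => f true * p x) fun x => f false * p x := by
  ext x
  by_cases hx : x ∈ A <;> simp [truth, hx]

lemma integrable_truth_mul (hA : MeasurableSet A) (f : Bool → ℝ) (hp : Integrable p) :
    Integrable fun x => f (truth A x) * p x := by
  classical
  rw [truth_mul_eq_piecewise]
  exact .piecewise hA (hp.const_mul _).integrableOn (hp.const_mul _).integrableOn

/-- The law of the true answer `I(X ∈ A)` when `X` has density `p`. -/
def answerLaw (p : Target d → ℝ) (A : Set (Target d)) : Bool → ℝ
  | true => mass p A
  | false => mass p Aᶜ

lemma integral_truth_mul (hA : MeasurableSet A) (f : Bool → ℝ) (hp : Integrable p) :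
    ∫ x, f (truth A x) * p x = ∑ z, answerLaw p A z * f z := by
  classical
  rw [truth_mul_eq_piecewise, integral_piecewise hA (hp.const_mul _).integrableOn
    (hp.const_mul _).integrableOn, integral_const_mul, integral_const_mul, Fintype.sum_bool]
  simp only [answerLaw, mass, mul_comm]

lemma answerLaw_nonneg (hp : ∀ x, 0 ≤ p x) (A : Set (Target d)) :
    ∀ z, 0 ≤ answerLaw p A z
  | true => integral_nonneg hp
  | false => integral_nonneg hp

lemma sum_answerLaw (hA : MeasurableSet A) (hp : Integrable p) :
    ∑ z, answerLaw p A z = ∫ x, p x := by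
  simpa using (integral_truth_mul hA (fun _ => 1) hp).symm

lemma IsDensityOn.sum_answerLaw {S : Set (Target d)} (hp : IsDensityOn S p)
    (hA : MeasurableSet A) : ∑ z, answerLaw p A z = 1 :=
  (TwentyQuestions.sum_answerLaw hA hp.integrable).trans hp.integral_eq_one

lemma IsDensityOn.answerLaw_eq_half_of_mass_eq_half {S : Set (Target d)} (hp : IsDensityOn S p)
    (hA : MeasurableSet A) (hhalf : mass p A = 1 / 2) : answerLaw p A = fun _ => 1 / 2 := by
  have htrue : answerLaw p A true = 1 / 2 := hhalf
  have hsum := hp.sum_answerLaw hA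
  rw [Fintype.sum_bool] at hsum
  ext z
  cases z <;> linarith

end Answer

section Bayes

variable {d : ℕ} {ε : ℝ} {S A : Set (Target d)} {p : Target d → ℝ}

/-- The differential entropy of `p` is finite, `∫ p |log₂ p| < ∞`. -/
def HasFiniteEntropy (p : Target d → ℝ) : Prop :=
  Integrable fun x => p x * Real.logb 2 (p x)

/-- The probability that a player with crossover probability `ε` responds `y` to the query `A`
when the target has density `p`; it is the normalizing constant in Bayes' rule. -/
def responseProb (ε : ℝ) (A : Set (Target d)) (p : Target d → ℝ) (y : Bool) : ℝ :=
  ∫ x, bsc ε (truth A x) y * p x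

lemma responseProb_eq_sum (ε : ℝ) (hA : MeasurableSet A) (hp : Integrable p) (y : Bool) :
    responseProb ε A p y = ∑ z, answerLaw p A z * bsc ε z y :=
  integral_truth_mul hA (bsc ε · y) hp

lemma responseProb_nonneg (hε : ε ∈ Set.Icc (0 : ℝ) 1) (A : Set (Target d)) (hp : ∀ x, 0 ≤ p x)
    (y : Bool) : 0 ≤ responseProb ε A p y :=
  integral_nonneg fun x => mul_nonneg (bsc_nonneg hε _ _) (hp x)

lemma sum_responseProb (ε : ℝ) (hA : MeasurableSet A) (hp : Integrable p) :
    ∑ y, responseProb ε A p y = ∫ x, p x := by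
  simp only [responseProb_eq_sum ε hA hp]
  rw [Finset.sum_comm]
  simp only [← Finset.mul_sum, sum_bsc, mul_one, sum_answerLaw hA hp]

lemma bsc_mul_ae_eq_zero (hε : ε ∈ Set.Icc (0 : ℝ) 1) (hA : MeasurableSet A)
    (hp : Integrable p) (hnonneg : ∀ x, 0 ≤ p x) {y : Bool} (hy : responseProb ε A p y = 0) :
    (fun x => bsc ε (truth A x) y * p x) =ᵐ[volume] fun _ => 0 :=
  (integral_eq_zero_iff_of_nonneg (fun x => mul_nonneg (bsc_nonneg hε _ _) (hnonneg x))
    (integrable_truth_mul hA (bsc ε · y) hp)).1 hy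

lemma responseProb_mul_bayesUpdate {y : Bool} (hy : responseProb ε A p y ≠ 0) (x : Target d) :
    responseProb ε A p y * bayesUpdate ε A y p x = bsc ε (truth A x) y * p x :=
  mul_div_cancel₀ _ hy

-- Bayes' rule gives `x / 0 = 0` for a response of probability zero; the right-hand side then
-- vanishes almost everywhere only.
lemma responseProb_mul_bayesUpdate_ae (hε : ε ∈ Set.Icc (0 : ℝ) 1) (hA : MeasurableSet A)
    (hp : Integrable p) (hnonneg : ∀ x, 0 ≤ p x) (y : Bool) :
    (fun x => responseProb ε A p y * bayesUpdate ε A y p x) =ᵐ[volume]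
      fun x => bsc ε (truth A x) y * p x := by
  by_cases hy : responseProb ε A p y = 0
  · simpa only [hy, zero_mul] using (bsc_mul_ae_eq_zero hε hA hp hnonneg hy).symm
  · exact .of_forall (responseProb_mul_bayesUpdate hy)

lemma responseProb_mul_bayesUpdate_mul_logb {y : Bool} (hy : responseProb ε A p y ≠ 0)
    (x : Target d) :
    responseProb ε A p y * (bayesUpdate ε A y p x * Real.logb 2 (bayesUpdate ε A y p x)) =
      bsc ε (truth A x) y *
          (Real.logb 2 (bsc ε (truth A x) y) - Real.logb 2 (responseProb ε A p y)) * p x +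
        bsc ε (truth A x) y * (p x * Real.logb 2 (p x)) := by
  rw [← mul_assoc, responseProb_mul_bayesUpdate hy]
  rcases eq_or_ne (p x) 0 with hp | hp
  · simp [hp]
  rcases eq_or_ne (bsc ε (truth A x) y) 0 with hw | hw
  · simp [hw]
  rw [bayesUpdate, ← responseProb, Real.logb_div (mul_ne_zero hw hp) hy, Real.logb_mul hw hp]
  ring

lemma IsDensityOn.bayesUpdate (hε : ε ∈ Set.Icc (0 : ℝ) 1) (hA : MeasurableSet A)
    (hp : IsDensityOn S p) {y : Bool} (hy : responseProb ε A p y ≠ 0) :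
    IsDensityOn S (bayesUpdate ε A y p) where
  measurable := (((measurable_of_countable (bsc ε · y)).comp (measurable_truth hA)).mul
    hp.measurable).div_const _
  nonneg x := div_nonneg (mul_nonneg (bsc_nonneg hε _ _) (hp.nonneg x))
    (responseProb_nonneg hε A hp.nonneg y)
  eq_zero x hx := by simp [TwentyQuestions.bayesUpdate, hp.eq_zero x hx]
  integrable := (integrable_truth_mul hA (bsc ε · y) hp.integrable).div_const _
  integral_eq_one := (integral_div _ _).trans (div_self hy)

lemma HasFiniteEntropy.bayesUpdate (hA : MeasurableSet A) (hp : Integrable p)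
    (hH : HasFiniteEntropy p) {y : Bool} (hy : responseProb ε A p y ≠ 0) :
    HasFiniteEntropy (bayesUpdate ε A y p) := by
  refine (integrable_const_mul_iff (IsUnit.mk0 _ hy) _).1 ?_
  simp only [responseProb_mul_bayesUpdate_mul_logb hy]
  exact (integrable_truth_mul hA (fun z => bsc ε z y * (Real.logb 2 (bsc ε z y) - _)) hp).add
    (integrable_truth_mul hA (bsc ε · y) hH)

lemma responseProb_mul_entropy_bayesUpdate (hε : ε ∈ Set.Icc (0 : ℝ) 1) (hA : MeasurableSet A)
    (hp : Integrable p) (hnonneg : ∀ x, 0 ≤ p x) (hH : HasFiniteEntropy p) (y : Bool) :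
    responseProb ε A p y * entropy (bayesUpdate ε A y p) =
      responseProb ε A p y * Real.logb 2 (responseProb ε A p y) -
        ∑ z, answerLaw p A z * (bsc ε z y * Real.logb 2 (bsc ε z y)) -
          ∫ x, bsc ε (truth A x) y * (p x * Real.logb 2 (p x)) := by
  by_cases hy : responseProb ε A p y = 0
  · have hanswer (z) : answerLaw p A z * bsc ε z y = 0 :=
      (Finset.sum_eq_zero_iff_of_nonneg fun z _ =>
        mul_nonneg (answerLaw_nonneg hnonneg A z) (bsc_nonneg hε z y)).1
        ((responseProb_eq_sum ε hA hp y).symm.trans hy) z (Finset.mem_univ z)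
    have hzero : ∫ x, bsc ε (truth A x) y * (p x * Real.logb 2 (p x)) = 0 :=
      integral_eq_zero_of_ae <| (bsc_mul_ae_eq_zero hε hA hp hnonneg hy).mono fun x hx => by
        simp only [← mul_assoc, hx, zero_mul, Pi.zero_apply]
    rw [hzero]
    simp only [hy, ← mul_assoc, hanswer, zero_mul, Finset.sum_const_zero, sub_zero]
  · let noise z := bsc ε z y * (Real.logb 2 (bsc ε z y) - Real.logb 2 (responseProb ε A p y))
    rw [entropy, mul_neg, ← integral_const_mul]
    simp only [responseProb_mul_bayesUpdate_mul_logb hy]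
    rw [integral_add (integrable_truth_mul hA noise hp) (integrable_truth_mul hA (bsc ε · y) hH),
      integral_truth_mul hA noise hp]
    simp only [noise, mul_sub, Finset.sum_sub_distrib, ← mul_assoc, ← Finset.sum_mul,
      ← responseProb_eq_sum ε hA hp]
    ring

lemma sum_responseProb_mul_entropy_bayesUpdate (hε : ε ∈ Set.Icc (0 : ℝ) 1)
    (hA : MeasurableSet A) (hp : Integrable p) (hnonneg : ∀ x, 0 ≤ p x)
    (hH : HasFiniteEntropy p) :
    ∑ y, responseProb ε A p y * entropy (bayesUpdate ε A y p) =
      entropy p - mutualInfo (answerLaw p A) (bsc ε) := by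
  have hprior : ∑ y, ∫ x, bsc ε (truth A x) y * (p x * Real.logb 2 (p x)) = -entropy p := by
    rw [← integral_finsetSum _ fun y _ => integrable_truth_mul hA (bsc ε · y) hH]
    simp only [← Finset.sum_mul, sum_bsc, one_mul, entropy, neg_neg]
  rw [mutualInfo_eq_sub (answerLaw_nonneg hnonneg A) (bsc_nonneg hε)]
  simp only [responseProb_mul_entropy_bayesUpdate hε hA hp hnonneg hH, Finset.sum_sub_distrib,
    hprior, Finset.mul_sum, ← responseProb_eq_sum ε hA hp]
  rw [Finset.sum_comm (f := fun y z => answerLaw p A z * (bsc ε z y * _))]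
  ring

end Bayes

lemma sum_fin_succ_pi {α β : Type*} [Fintype α] [AddCommMonoid β] {n : ℕ}
    (f : (Fin (n + 1) → α) → β) :
    ∑ y, f y = ∑ y : Fin n → α, ∑ b, f (Fin.snoc (α := fun _ => α) y b) := by
  rw [← (Fin.snocEquiv fun _ : Fin (n + 1) => α).sum_comp, Fintype.sum_prod_type, Finset.sum_comm]
  rfl

variable {d M : ℕ}

/-- The first `n` queries of the policy are measurable sets, whatever the responses. -/
def Policy.HasMeasurableQueries (ξ : Policy d M) (n : ℕ) : Prop :=
  ∀ k < n, ∀ y, MeasurableSet (ξ.query k y)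

lemma Policy.HasMeasurableQueries.mono {ξ : Policy d M} {m n : ℕ} (hξ : ξ.HasMeasurableQueries n)
    (hmn : m ≤ n) : ξ.HasMeasurableQueries m :=
  fun k hk => hξ k (hk.trans_le hmn)

namespace Problem

variable {P : Problem d M} {ξ : Policy d M}

lemma Admissible.hasMeasurableQueries (hξ : P.Admissible ξ) :
    ξ.HasMeasurableQueries P.horizon :=
  fun n hn y => (hξ n hn y).measurableSet

section Likelihood

lemma likelihood_nonneg (hcrossover : ∀ n u, P.crossover n u ∈ Set.Icc (0 : ℝ) 1) :
    ∀ n x y, 0 ≤ P.likelihood ξ n x y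
  | 0, _, _ => zero_le_one
  | n + 1, x, _ => mul_nonneg (likelihood_nonneg hcrossover n x _) (bsc_nonneg (hcrossover _ _) _ _)

variable (P ξ) in
lemma sum_likelihood : ∀ n x, ∑ y, P.likelihood ξ n x y = 1
  | 0, _ => by simp [likelihood]
  | n + 1, x => by
    simp only [sum_fin_succ_pi, likelihood, Fin.init_snoc, Fin.snoc_last, ← Finset.mul_sum,
      sum_bsc, mul_one, sum_likelihood n x]

lemma measurable_likelihood :
    ∀ {n : ℕ}, ξ.HasMeasurableQueries n → ∀ y, Measurable fun x => P.likelihood ξ n x y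
  | 0, _, _ => measurable_const
  | n + 1, hξ, _ =>
    (measurable_likelihood (hξ.mono n.le_succ) _).mul
      ((measurable_of_countable (bsc _ · _)).comp (measurable_truth (hξ n n.lt_succ_self _)))

lemma integrable_prior_mul_likelihood (hprior : Integrable P.prior) :
    ∀ {n : ℕ}, ξ.HasMeasurableQueries n → ∀ y,
      Integrable fun x => P.prior x * P.likelihood ξ n x y
  | 0, _, _ => by simpa only [likelihood, mul_one] using hprior
  | n + 1, hξ, y => by
    refine (integrable_truth_mul (hξ n n.lt_succ_self (Fin.init y))
      (bsc (P.crossover n (ξ.player n (Fin.init y))) · (y (Fin.last n)))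
      (integrable_prior_mul_likelihood hprior (hξ.mono n.le_succ) (Fin.init y))).congr
      (.of_forall fun x => ?_)
    simp only [likelihood]
    ring

end Likelihood

section Evidence

variable {S : Set (Target d)} {n : ℕ}

variable (P) in
/-- The probability that the first `n` responses are `y`, as a product of the successive
conditional probabilities given the past. -/
def evidence (ξ : Policy d M) : (n : ℕ) → (Fin n → Bool) → ℝ
  | 0, _ => 1
  | n + 1, y => evidence ξ n (Fin.init y) *
      responseProb (P.crossover n (ξ.player n (Fin.init y))) (ξ.query n (Fin.init y))
        (P.posterior ξ n (Fin.init y)) (y (Fin.last n))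

lemma isDensityOn_posterior (hprior : IsDensityOn S P.prior)
    (hcrossover : ∀ n u, P.crossover n u ∈ Set.Icc (0 : ℝ) 1) :
    ∀ {n : ℕ}, ξ.HasMeasurableQueries n → ∀ {y}, P.evidence ξ n y ≠ 0 →
      IsDensityOn S (P.posterior ξ n y)
  | 0, _, _, _ => hprior
  | n + 1, hξ, _, hy =>
    (isDensityOn_posterior hprior hcrossover (hξ.mono n.le_succ)
      (left_ne_zero_of_mul hy)).bayesUpdate (hcrossover _ _) (hξ n n.lt_succ_self _)
        (right_ne_zero_of_mul hy)

lemma hasFiniteEntropy_posterior (hprior : IsDensityOn S P.prior)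
    (hentropy : HasFiniteEntropy P.prior)
    (hcrossover : ∀ n u, P.crossover n u ∈ Set.Icc (0 : ℝ) 1) :
    ∀ {n : ℕ}, ξ.HasMeasurableQueries n → ∀ {y}, P.evidence ξ n y ≠ 0 →
      HasFiniteEntropy (P.posterior ξ n y)
  | 0, _, _, _ => hentropy
  | n + 1, hξ, _, hy =>
    (hasFiniteEntropy_posterior hprior hentropy hcrossover (hξ.mono n.le_succ)
      (left_ne_zero_of_mul hy)).bayesUpdate (hξ n n.lt_succ_self _)
        (isDensityOn_posterior hprior hcrossover (hξ.mono n.le_succ)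
          (left_ne_zero_of_mul hy)).integrable (right_ne_zero_of_mul hy)

lemma prior_mul_likelihood_ae (hprior : IsDensityOn S P.prior)
    (hcrossover : ∀ n u, P.crossover n u ∈ Set.Icc (0 : ℝ) 1) :
    ∀ {n : ℕ}, ξ.HasMeasurableQueries n → ∀ y,
      (fun x => P.prior x * P.likelihood ξ n x y) =ᵐ[volume]
        fun x => P.evidence ξ n y * P.posterior ξ n y x
  | 0, _, _ => .of_forall fun x => by simp only [likelihood, evidence, posterior, mul_one, one_mul]
  | n + 1, hξ, y => by
    have ih := prior_mul_likelihood_ae hprior hcrossover (hξ.mono n.le_succ) (Fin.init y)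
    by_cases hy : P.evidence ξ n (Fin.init y) = 0
    · filter_upwards [ih] with x hx
      simp only [likelihood, evidence, ← mul_assoc, hx, hy, zero_mul]
    · have hpost := isDensityOn_posterior hprior hcrossover (hξ.mono n.le_succ) hy
      filter_upwards [ih, responseProb_mul_bayesUpdate_ae (hcrossover _ _)
        (hξ n n.lt_succ_self _) hpost.integrable hpost.nonneg (y (Fin.last n))] with x hx hbayes
      simp only [likelihood, evidence, posterior]
      rw [← mul_assoc, hx, mul_assoc, mul_assoc, hbayes, mul_comm (P.posterior _ _ _ _)]

lemma integral_prior_mul_likelihood (hprior : IsDensityOn S P.prior)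
    (hcrossover : ∀ n u, P.crossover n u ∈ Set.Icc (0 : ℝ) 1) (hξ : ξ.HasMeasurableQueries n)
    (y : Fin n → Bool) : ∫ x, P.prior x * P.likelihood ξ n x y = P.evidence ξ n y := by
  rw [integral_congr_ae (prior_mul_likelihood_ae hprior hcrossover hξ y), integral_const_mul]
  by_cases hy : P.evidence ξ n y = 0
  · rw [hy, zero_mul]
  · rw [(isDensityOn_posterior hprior hcrossover hξ hy).integral_eq_one, mul_one]

lemma evidence_nonneg (hprior : IsDensityOn S P.prior)
    (hcrossover : ∀ n u, P.crossover n u ∈ Set.Icc (0 : ℝ) 1) (hξ : ξ.HasMeasurableQueries n)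
    (y : Fin n → Bool) : 0 ≤ P.evidence ξ n y :=
  integral_prior_mul_likelihood hprior hcrossover hξ y ▸
    integral_nonneg fun x => mul_nonneg (hprior.nonneg x) (likelihood_nonneg hcrossover n x y)

lemma sum_evidence (hprior : IsDensityOn S P.prior)
    (hcrossover : ∀ n u, P.crossover n u ∈ Set.Icc (0 : ℝ) 1) (hξ : ξ.HasMeasurableQueries n) :
    ∑ y, P.evidence ξ n y = 1 := by
  simp only [← integral_prior_mul_likelihood hprior hcrossover hξ]
  rw [← integral_finsetSum _ fun y _ => integrable_prior_mul_likelihood hprior.integrable hξ y]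
  simp only [← Finset.mul_sum, sum_likelihood, mul_one, hprior.integral_eq_one]

lemma sum_evidence_mul_le (hprior : IsDensityOn S P.prior)
    (hcrossover : ∀ n u, P.crossover n u ∈ Set.Icc (0 : ℝ) 1) (hξ : ξ.HasMeasurableQueries n)
    {f : (Fin n → Bool) → ℝ} {c : ℝ} (hf : ∀ y, P.evidence ξ n y ≠ 0 → f y ≤ c) :
    ∑ y, P.evidence ξ n y * f y ≤ c := by
  have hterm (y) : P.evidence ξ n y * f y ≤ P.evidence ξ n y * c := by
    rcases (evidence_nonneg hprior hcrossover hξ y).eq_or_lt with hy | hy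
    · rw [← hy, zero_mul, zero_mul]
    · exact mul_le_mul_of_nonneg_left (hf y hy.ne') hy.le
  calc ∑ y, P.evidence ξ n y * f y
      ≤ ∑ y, P.evidence ξ n y * c := Finset.sum_le_sum fun y _ => hterm y
    _ = c := by rw [← Finset.sum_mul, sum_evidence hprior hcrossover hξ, one_mul]

lemma le_sum_evidence_mul (hprior : IsDensityOn S P.prior)
    (hcrossover : ∀ n u, P.crossover n u ∈ Set.Icc (0 : ℝ) 1) (hξ : ξ.HasMeasurableQueries n)
    {f : (Fin n → Bool) → ℝ} {c : ℝ} (hf : ∀ y, P.evidence ξ n y ≠ 0 → c ≤ f y) :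
    c ≤ ∑ y, P.evidence ξ n y * f y := by
  have hneg := sum_evidence_mul_le hprior hcrossover hξ fun y hy => neg_le_neg (hf y hy)
  simpa only [mul_neg, Finset.sum_neg_distrib, neg_le_neg_iff] using hneg

lemma integral_law (hprior : IsDensityOn S P.prior)
    (hcrossover : ∀ n u, P.crossover n u ∈ Set.Icc (0 : ℝ) 1)
    (hξ : ξ.HasMeasurableQueries P.horizon) (f : (Fin P.horizon → Bool) → ℝ) :
    ∫ ω, f ω.2 ∂(P.law ξ) = ∑ y, P.evidence ξ P.horizon y * f y := by
  have hmeas : Measurable fun ω : Target d × (Fin P.horizon → Bool) =>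
      P.prior ω.1 * P.likelihood ξ P.horizon ω.1 ω.2 :=
    measurable_from_prod_countable_left fun y =>
      hprior.measurable.mul (measurable_likelihood hξ y)
  have htoReal (ω : Target d × (Fin P.horizon → Bool)) :
      (ENNReal.ofReal (P.prior ω.1 * P.likelihood ξ P.horizon ω.1 ω.2)).toReal =
        P.prior ω.1 * P.likelihood ξ P.horizon ω.1 ω.2 :=
    ENNReal.toReal_ofReal (mul_nonneg (hprior.nonneg _) (likelihood_nonneg hcrossover _ _ _))
  have hint : Integrable (fun ω : Target d × (Fin P.horizon → Bool) =>
      P.prior ω.1 * P.likelihood ξ P.horizon ω.1 ω.2 * f ω.2)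
      ((volume : Measure (Target d)).prod Measure.count) :=
    (integrable_prod_iff' (hmeas.mul
      ((measurable_of_countable f).comp measurable_snd)).aestronglyMeasurable).2
      ⟨.of_forall fun y => (integrable_prior_mul_likelihood hprior.integrable hξ y).mul_const (f y),
        .of_finite⟩
  rw [law, integral_withDensity_eq_integral_toReal_smul hmeas.ennreal_ofReal (by simp)]
  simp only [htoReal, smul_eq_mul]
  rw [integral_prod_symm _ hint, integral_count]
  simp only [integral_mul_const, integral_prior_mul_likelihood hprior hcrossover hξ]

end Evidence

section Value

variable {S : Set (Target d)} {n : ℕ}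

variable (P) in
/-- The expectation of `H(p_n) + γ T_n` under the policy `ξ`. -/
def expectedValue (ξ : Policy d M) (n : ℕ) : ℝ :=
  ∑ y, P.evidence ξ n y * (entropy (P.posterior ξ n y) + P.γ * P.totalCost ξ n y)

variable (P) in
/-- The mutual information, given the first `n` responses `y`, between the true answer to the
query at time `n` and the response to it. -/
def infoGain (ξ : Policy d M) (n : ℕ) (y : Fin n → Bool) : ℝ :=
  mutualInfo (answerLaw (P.posterior ξ n y) (ξ.query n y)) (bsc (P.crossover n (ξ.player n y)))

variable (P) in
/-- The mutual information gained by the question at time `n` when the first `n` responses are `y`,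
net of its cost weighted by `γ`. -/
def netGain (ξ : Policy d M) (n : ℕ) (y : Fin n → Bool) : ℝ :=
  P.infoGain ξ n y - P.γ * P.cost n (ξ.player n y) (ξ.query n y)

variable (P) in
/-- The net capacity `C_n(u) - γ K_n(u, A)` of asking player `u` the query `A` at time `n`. -/
def netCapacity (n : ℕ) (u : Fin M) (A : Set (Target d)) : ℝ :=
  P.playerCapacity n u - P.γ * P.cost n u A

lemma expectedValue_zero : P.expectedValue ξ 0 = entropy P.prior := by
  simp [expectedValue, evidence, posterior, totalCost]

lemma expectedValue_succ (hprior : IsDensityOn S P.prior) (hentropy : HasFiniteEntropy P.prior)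
    (hcrossover : ∀ n u, P.crossover n u ∈ Set.Icc (0 : ℝ) 1)
    (hξ : ξ.HasMeasurableQueries (n + 1)) :
    P.expectedValue ξ (n + 1) =
      P.expectedValue ξ n - ∑ y, P.evidence ξ n y * P.netGain ξ n y := by
  rw [expectedValue, sum_fin_succ_pi, expectedValue, ← Finset.sum_sub_distrib]
  refine Finset.sum_congr rfl fun y _ => ?_
  simp only [evidence, posterior, totalCost, Fin.init_snoc, Fin.snoc_last]
  by_cases hy : P.evidence ξ n y = 0
  · simp [hy]
  have hA := hξ n n.lt_succ_self y
  have hpost := isDensityOn_posterior hprior hcrossover (hξ.mono n.le_succ) hy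
  have hinfo := sum_responseProb_mul_entropy_bayesUpdate (hcrossover n (ξ.player n y)) hA
    hpost.integrable hpost.nonneg
    (hasFiniteEntropy_posterior hprior hentropy hcrossover (hξ.mono n.le_succ) hy)
  have hsum := (sum_responseProb (P.crossover n (ξ.player n y)) hA hpost.integrable).trans
    hpost.integral_eq_one
  simp only [mul_assoc, mul_add, Finset.sum_add_distrib, ← Finset.mul_sum, ← Finset.sum_mul,
    hinfo, hsum, netGain, infoGain]
  ring

lemma expectedValue_eq_entropy_sub_sum (hprior : IsDensityOn S P.prior)
    (hentropy : HasFiniteEntropy P.prior)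
    (hcrossover : ∀ n u, P.crossover n u ∈ Set.Icc (0 : ℝ) 1) :
    ∀ {n : ℕ}, ξ.HasMeasurableQueries n → P.expectedValue ξ n =
      entropy P.prior - ∑ k ∈ Finset.range n, ∑ y, P.evidence ξ k y * P.netGain ξ k y
  | 0, _ => by rw [expectedValue_zero, Finset.sum_range_zero, sub_zero]
  | n + 1, hξ => by
    rw [expectedValue_succ hprior hentropy hcrossover hξ,
      expectedValue_eq_entropy_sub_sum hprior hentropy hcrossover (hξ.mono n.le_succ),
      Finset.sum_range_succ, sub_sub]

lemma objective_eq_entropy_sub_sum (hprior : IsDensityOn S P.prior)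
    (hentropy : HasFiniteEntropy P.prior)
    (hcrossover : ∀ n u, P.crossover n u ∈ Set.Icc (0 : ℝ) 1)
    (hξ : ξ.HasMeasurableQueries P.horizon) :
    P.objective ξ = entropy P.prior -
      ∑ n ∈ Finset.range P.horizon, ∑ y, P.evidence ξ n y * P.netGain ξ n y :=
  (integral_law hprior hcrossover hξ _).trans
    (expectedValue_eq_entropy_sub_sum hprior hentropy hcrossover hξ)

lemma netGain_le_netCapacity (hprior : IsDensityOn S P.prior)
    (hcrossover : ∀ n u, P.crossover n u ∈ Set.Icc (0 : ℝ) 1)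
    (hξ : ξ.HasMeasurableQueries (n + 1)) {y : Fin n → Bool} (hy : P.evidence ξ n y ≠ 0) :
    P.netGain ξ n y ≤ P.netCapacity n (ξ.player n y) (ξ.query n y) :=
  have hpost := isDensityOn_posterior hprior hcrossover (hξ.mono n.le_succ) hy
  sub_le_sub_right (mutualInfo_le_capacity_bsc (hcrossover _ _) (answerLaw_nonneg hpost.nonneg _)
    (hpost.sum_answerLaw (hξ n n.lt_succ_self y))) _

lemma netGain_eq_netCapacity_of_mass_eq_half (hprior : IsDensityOn S P.prior)
    (hcrossover : ∀ n u, P.crossover n u ∈ Set.Icc (0 : ℝ) 1)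
    (hξ : ξ.HasMeasurableQueries (n + 1)) {y : Fin n → Bool} (hy : P.evidence ξ n y ≠ 0)
    (hbisection : mass (P.posterior ξ n y) (ξ.query n y) = 1 / 2) :
    P.netGain ξ n y = P.netCapacity n (ξ.player n y) (ξ.query n y) := by
  have hpost := isDensityOn_posterior hprior hcrossover (hξ.mono n.le_succ) hy
  rw [netGain, netCapacity, infoGain,
    hpost.answerLaw_eq_half_of_mass_eq_half (hξ n n.lt_succ_self y) hbisection,
    playerCapacity, capacity_bsc (hcrossover _ _)]

lemma entropy_sub_sum_le_objective (hprior : IsDensityOn S P.prior)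
    (hentropy : HasFiniteEntropy P.prior)
    (hcrossover : ∀ n u, P.crossover n u ∈ Set.Icc (0 : ℝ) 1)
    (hξ : ξ.HasMeasurableQueries P.horizon) {G : ℕ → ℝ}
    (hG : ∀ n < P.horizon, ∀ y, P.netCapacity n (ξ.player n y) (ξ.query n y) ≤ G n) :
    entropy P.prior - ∑ n ∈ Finset.range P.horizon, G n ≤ P.objective ξ := by
  rw [objective_eq_entropy_sub_sum hprior hentropy hcrossover hξ]
  refine sub_le_sub_left (Finset.sum_le_sum fun n hn => ?_) _
  rw [Finset.mem_range] at hn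
  exact sum_evidence_mul_le hprior hcrossover (hξ.mono hn.le) fun y hy =>
    (netGain_le_netCapacity hprior hcrossover (hξ.mono hn) hy).trans (hG n hn y)

lemma objective_le_entropy_sub_sum (hprior : IsDensityOn S P.prior)
    (hentropy : HasFiniteEntropy P.prior)
    (hcrossover : ∀ n u, P.crossover n u ∈ Set.Icc (0 : ℝ) 1)
    (hξ : ξ.HasMeasurableQueries P.horizon)
    (hbisection : ∀ n < P.horizon, ∀ y, mass (P.posterior ξ n y) (ξ.query n y) = 1 / 2)
    {G : ℕ → ℝ}
    (hG : ∀ n < P.horizon, ∀ y, G n ≤ P.netCapacity n (ξ.player n y) (ξ.query n y)) :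
    P.objective ξ ≤ entropy P.prior - ∑ n ∈ Finset.range P.horizon, G n := by
  rw [objective_eq_entropy_sub_sum hprior hentropy hcrossover hξ]
  refine sub_le_sub_left (Finset.sum_le_sum fun n hn => ?_) _
  rw [Finset.mem_range] at hn
  exact le_sum_evidence_mul hprior hcrossover (hξ.mono hn.le) fun y hy =>
    (hG n hn y).trans_eq
      (netGain_eq_netCapacity_of_mass_eq_half hprior hcrossover (hξ.mono hn) hy
        (hbisection n hn y)).symm

end Value

end Problem

end TwentyQuestions

theorem corollary1_general {d M : ℕ} (P : TwentyQuestions.Problem d M)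
    (hprior : TwentyQuestions.IsDensityOn P.domain P.prior)
    (hentropy : TwentyQuestions.HasFiniteEntropy P.prior)
    (hcrossover : ∀ n u, P.crossover n u ∈ Set.Icc (0 : ℝ) 1)
    (ζ : TwentyQuestions.Policy d M)
    (hadmissible : P.Admissible ζ)
    (hmax : ∀ n < P.horizon, ∀ y : Fin n → Bool, ∀ u A,
      TwentyQuestions.IsQueryRegion P.domain (P.maxRect n u) A →
        P.netCapacity n u A ≤ P.netCapacity n (ζ.player n y) (ζ.query n y))
    (hbisection : ∀ n < P.horizon, ∀ y : Fin n → Bool,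
      TwentyQuestions.mass (P.posterior ζ n y) (ζ.query n y) = 1 / 2) :
    P.IsOptimal ζ := by
  -- By `hmax` the net capacity selected at time `n` does not depend on the responses received.
  let G n := P.netCapacity n (ζ.player n fun _ => false) (ζ.query n fun _ => false)
  have hζ : P.objective ζ ≤
      TwentyQuestions.entropy P.prior - ∑ n ∈ Finset.range P.horizon, G n :=
    TwentyQuestions.Problem.objective_le_entropy_sub_sum hprior hentropy hcrossover
      hadmissible.hasMeasurableQueries hbisection
      fun n hn y => hmax n hn y _ _ (hadmissible n hn _)
  refine ⟨hadmissible, ⟨ζ, hadmissible, rfl⟩, Set.forall_mem_image.2 fun ξ hξ => hζ.trans ?_⟩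
  exact TwentyQuestions.Problem.entropy_sub_sum_le_objective hprior hentropy hcrossover
    hξ.hasMeasurableQueries fun n hn y => hmax n hn _ _ _ (hξ n hn y)

end

theorem corollary1 {d M : ℕ} (P : TwentyQuestions.Problem d M)
    (hprior : TwentyQuestions.IsDensityOn P.domain P.prior)
    (hentropy : MeasureTheory.Integrable
      (fun x => P.prior x * Real.logb 2 (P.prior x)) MeasureTheory.volume)
    (hcrossover : ∀ n u, P.crossover n u ∈ Set.Ioo (0 : ℝ) (1 / 2))
    (hγ : 0 ≤ P.γ)
    (K : ℕ → Fin M → ℝ)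
    (hcost : ∀ n u A, TwentyQuestions.IsQueryRegion P.domain (P.maxRect n u) A →
      P.cost n u A = K n u)
    (ζ : TwentyQuestions.Policy d M)
    (hadmissible : P.Admissible ζ)
    (hplayer : ∀ n < P.horizon, ∀ y : Fin n → Bool,
      IsMaxOn (fun u => P.playerCapacity n u - P.γ * K n u) Set.univ (ζ.player n y))
    (hbisection : ∀ n < P.horizon, ∀ y : Fin n → Bool,
      TwentyQuestions.mass (P.posterior ζ n y) (ζ.query n y) = 1 / 2) :
    P.IsOptimal ζ := by
  refine corollary1_general P hprior hentropy
    (fun n u => ⟨(hcrossover n u).1.le, by linarith [(hcrossover n u).2]⟩) ζ hadmissible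
    (fun n hn y u A hA => ?_) hbisection
  simpa only [TwentyQuestions.Problem.netCapacity, hcost n u A hA,
    hcost n _ _ (hadmissible n hn y)] using isMaxOn_univ_iff.1 (hplayer n hn y) u
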